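/- Let $(\mathcal X,\mathsf d)$ be a separable metric space with Borel $\sigma$-algebra $\mathfrak B(\mathcal X)$, let $\mu$ be a probability measure on $\mathcal X\times\{0,1\}$ with first marginal $\rho$, and let $\varepsilon>0$. Put $w_i=\mu(\mathcal X\times\{i\})$ and $\rho_i(A)=\mu(A\times\{i\})/w_i$ for $i\in\{0,1\}$ (a term carrying the factor $w_i$ is $0$ if $w_i=0$), and write $B_r(x)$ for open balls, $\mathsf{dist}(x,A)=\inf_{a\in A}\mathsf d(x,a)$ with $\mathsf{dist}(x,\emptyset)=\infty$. Let $\nu$ be a finite Borel measure on $\mathcal X$ such that $\rho\ll\nu$, $\{x:\mathsf{dist}(x,\operatorname{supp}\rho)<\varepsilon\}\subseteq\operatorname{supp}\nu$, and $\limsup_{r\downarrow0}\nu(B_{2r}(x))/\nu(B_r(x))<\infty$ for $\nu$-a.e. $x$. *Problems.* The adversarial problem is $$\inf_{A\in\mathfrak B(\mathcal X)}\ \mathbb E_{(x,y)\sim\mu}\Big[\sup_{\tilde x\in B_\varepsilon(x)}|1_A(\tilde x)-y|\Big].\tag{1}$$ Write $A\sim_\nu B$ if $\nu(A\triangle B)=0$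 and $A\preceq_\nu B$ if $1_A\le1_B$ $\nu$-a.e., and set $$\widetilde{\operatorname{Per}}_\varepsilon(A)=\frac{w_0}{\varepsilon}\int\Big(\sup_{B_\varepsilon(x)}1_A-1_A(x)\Big)d\rho_0(x)+\frac{w_1}{\varepsilon}\int\Big(1_A(x)-\inf_{B_\varepsilon(x)}1_A\Big)d\rho_1(x),$$ $\operatorname{Per}^\nu_\varepsilon(A)=\inf\{\widetilde{\operatorname{Per}}_\varepsilon(B):B\in\mathfrak B(\mathcal X),\,B\sim_\nu A\}$. The regularized problem is $$\inf_{A\in\mathfrak B(\mathcal X)}\ \mathbb E_{(x,y)\sim\mu}|1_A(x)-y|+\varepsilon\operatorname{Per}^\nu_\varepsilon(A).\tag{2}$$ Solutions are Borel sets attaining the infimum. A solution $A$ of (2) is maximal (minimal) if every solution $A'$ of (2) with $A\preceq_\nu A'$ ($A'\preceq_\nu A$) satisfies $A\sim_\nu A'$. *Representatives and morphology.* For Borel $A$ let $$A^+=\Big\{x\in\operatorname{supp}\nu:\limsup_{r\downarrow0}\tfrac{\nu(B_r(x)\cap A)}{\nu(B_r(x))}>0\Big\}\cup(\mathcal X\setminus\operatorname{supp}\nu),\qquad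 A^-=\Big\{x\in\operatorname{supp}\nu:\liminf_{r\downarrow0}\tfrac{\nu(B_r(x)\cap A)}{\nu(B_r(x))}=1\Big\}.$$ For $A\subseteq\mathcal X$ let $A^{\varepsilon}=\{x:\mathsf{dist}(x,A)<\varepsilon\}$, $A^{-\varepsilon}=\{x:\mathsf{dist}(x,A^c)\ge\varepsilon\}$, $\operatorname{cl}_\varepsilon(A)=(A^\varepsilon)^{-\varepsilon}$, $\operatorname{op}_\varepsilon(A)=(A^{-\varepsilon})^\varepsilon$. The set $A$ is called $\varepsilon$ inner (outer) regular if for every $x\in\partial A$ there is $y\in\mathcal X$ with $\mathsf d(x,y)=\varepsilon$ and $B_\varepsilon(y)\subseteq A$ ($B_\varepsilon(y)\subseteq A^c$). *Claim.* Problem (2) has a maximal solution and a minimal solution, and there exist two solutions $A'_+$ and $A'_-$ of the adversarial problem (1) with the following properties: 1. $A'_-\subseteq A'_+$. 2. $A'_+$ is closed and $A'_-$ is open. 3. Suppose that distances equal to $\varepsilon$ are attained in $\mathcal X$, i.e. for every $x\in\mathcal X$ and every closed $C\subseteq\mathcal X$ with $\mathsf{dist}(x,C)=\varepsilon$ there is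 $y\in C$ with $\mathsf d(x,y)=\varepsilon$ (this holds whenever closed bounded subsets of $\mathcal X$ are compact, e.g. in $\mathbb R^d$ with an $\ell^p$-metric). Then $A'_+$ is $\varepsilon$ outer regular and $A'_-$ is $\varepsilon$ inner regular. 4. For every maximal solution $A_{\max}$ and every minimal solution $A_{\min}$ of (2): $A_{\max}\sim_\nu A'_+$ and $A_{\min}\sim_\nu A'_-$; moreover $A'_+=\operatorname{cl}_\varepsilon(A_{\max}^+)$ and $A'_-=\operatorname{op}_\varepsilon(A_{\min}^-)$. -/

import Mathlib

namespace AdvTraining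

noncomputable section

open MeasureTheory Set Filter
open scoped ENNReal Topology symmDiff

variable {X : Type*} [MetricSpace X] [MeasurableSpace X]

/-! ### Data distribution

`μ` is the distribution of pairs `(x, y)` of a feature `x : X` and a label `y ∈ {0, 1}`. -/

/-- The first marginal of `μ`, i.e. the distribution of the input data. -/
def dataMarginal (μ : Measure (X × Fin 2)) : Measure X := μ.map Prod.fst

/-- The class probability `w_i = μ (X × {i})`. -/
def classWeight (μ : Measure (X × Fin 2)) (i : Fin 2) : ℝ≥0∞ := μ (Prod.snd ⁻¹' {i})

/-- The conditional distribution `ρ_i (A) = μ (A × {i}) / w_i` of the features given the label. -/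
def classDist (μ : Measure (X × Fin 2)) (i : Fin 2) : Measure X :=
  (ProbabilityTheory.cond μ (Prod.snd ⁻¹' {i})).map Prod.fst

/-- The indicator function `1_A`, with values in `[0, ∞]`. -/
def ind (A : Set X) (x : X) : ℝ≥0∞ := A.indicator 1 x

/-- The zero-one loss `|1_A(x) - y|`, as an extended nonnegative number. -/
def loss (A : Set X) (x : X) (y : Fin 2) : ℝ≥0∞ :=
  ENNReal.ofReal |A.indicator (1 : X → ℝ) x - ((y : ℕ) : ℝ)|

/-! ### The adversarial problem -/

/-- The adversarial risk `E_{(x,y) ∼ μ} [ sup_{x' ∈ B_ε(x)} |1_A(x') - y| ]`, with open balls. -/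
def advRisk (ε : ℝ) (μ : Measure (X × Fin 2)) (A : Set X) : ℝ≥0∞ :=
  ∫⁻ z, ⨆ x' ∈ Metric.ball z.1 ε, loss A x' z.2 ∂μ

/-- `A` is a solution of the adversarial problem: a Borel set that minimizes the adversarial risk
among all Borel sets. -/
def IsAdvSolution (ε : ℝ) (μ : Measure (X × Fin 2)) (A : Set X) : Prop :=
  MeasurableSet A ∧ ∀ B : Set X, MeasurableSet B → advRisk ε μ A ≤ advRisk ε μ B

/-! ### The perimeter-regularized problem -/

/-- The equivalence `A ∼_ν B`, i.e. `ν (A ∆ B) = 0`. -/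
def NuEquiv (ν : Measure X) (A B : Set X) : Prop := ν (A ∆ B) = 0

/-- The preorder `A ≼_ν B`, i.e. `1_A ≤ 1_B` holds `ν`-almost everywhere. -/
def NuLE (ν : Measure X) (A B : Set X) : Prop := ∀ᵐ x ∂ν, ind A x ≤ ind B x

/-- The nonlocal pre-perimeter
`(w₀/ε) ∫ (sup_{B_ε(x)} 1_A - 1_A(x)) dρ₀(x) + (w₁/ε) ∫ (1_A(x) - inf_{B_ε(x)} 1_A) dρ₁(x)`.
Both integrands are nonnegative for `ε > 0`, so that the subtraction of `ℝ≥0∞` is the usual one. -/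
def prePerimeter (ε : ℝ) (μ : Measure (X × Fin 2)) (A : Set X) : ℝ≥0∞ :=
  classWeight μ 0 / ENNReal.ofReal ε *
      ∫⁻ x, ((⨆ x' ∈ Metric.ball x ε, ind A x') - ind A x) ∂(classDist μ 0)
    + classWeight μ 1 / ENNReal.ofReal ε *
      ∫⁻ x, (ind A x - ⨅ x' ∈ Metric.ball x ε, ind A x') ∂(classDist μ 1)

/-- The nonlocal perimeter with respect to `ν`: the infimum of the pre-perimeter over all Borel
sets that are `ν`-equivalent to `A`. -/
def perimeter (ν : Measure X) (ε : ℝ) (μ : Measure (X × Fin 2)) (A : Set X) : ℝ≥0∞ :=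
  ⨅ (B : Set X) (_ : MeasurableSet B) (_ : NuEquiv ν A B), prePerimeter ε μ B

/-- The objective `E_{(x,y) ∼ μ} |1_A(x) - y| + ε Per_ε(A; μ)`. -/
def perRisk (ν : Measure X) (ε : ℝ) (μ : Measure (X × Fin 2)) (A : Set X) : ℝ≥0∞ :=
  ∫⁻ z, loss A z.1 z.2 ∂μ + ENNReal.ofReal ε * perimeter ν ε μ A

/-- `A` is a solution of the perimeter-regularized problem. -/
def IsPerSolution (ν : Measure X) (ε : ℝ) (μ : Measure (X × Fin 2)) (A : Set X) : Prop :=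
  MeasurableSet A ∧ ∀ B : Set X, MeasurableSet B → perRisk ν ε μ A ≤ perRisk ν ε μ B

/-- `A` is a maximal solution of the perimeter-regularized problem. -/
def IsMaxPerSolution (ν : Measure X) (ε : ℝ) (μ : Measure (X × Fin 2)) (A : Set X) : Prop :=
  IsPerSolution ν ε μ A ∧ ∀ A' : Set X, IsPerSolution ν ε μ A' → NuLE ν A A' → NuEquiv ν A A'

/-- `A` is a minimal solution of the perimeter-regularized problem. -/
def IsMinPerSolution (ν : Measure X) (ε : ℝ) (μ : Measure (X × Fin 2)) (A : Set X) : Prop :=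
  IsPerSolution ν ε μ A ∧ ∀ A' : Set X, IsPerSolution ν ε μ A' → NuLE ν A' A → NuEquiv ν A A'

/-- The standing assumption on the reference measure `ν` (which is moreover finite): the data
distribution is absolutely continuous with respect to `ν`, the open `ε`-neighbourhood of its
support lies in the support of `ν`, and `ν` is locally doubling at `ν`-almost every point. -/
structure IsReferenceMeasure (ν : Measure X) (ε : ℝ) (μ : Measure (X × Fin 2)) : Prop where
  absolutelyContinuous : dataMarginal μ ≪ ν
  thickening_subset : Metric.thickening ε (dataMarginal μ).support ⊆ ν.support
  locallyDoubling : ∀ᵐ x ∂ν,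
    limsup (fun r : ℝ => ν (Metric.ball x (2 * r)) / ν (Metric.ball x r)) (𝓝[>] 0) < ∞

/-! ### Density-based representatives -/

/-- The representative `A⁺`: points outside the support of `ν` and points of the support at which
the upper density of `A` is positive. -/
def upperRep (ν : Measure X) (A : Set X) : Set X :=
  {x | x ∈ ν.support →
    0 < limsup (fun r : ℝ => ν (Metric.ball x r ∩ A) / ν (Metric.ball x r)) (𝓝[>] 0)}

/-- The representative `A⁻`: points of the support of `ν` at which the lower density of `A` is
one. -/
def lowerRep (ν : Measure X) (A : Set X) : Set X :=
  {x | x ∈ ν.support ∧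
    liminf (fun r : ℝ => ν (Metric.ball x r ∩ A) / ν (Metric.ball x r)) (𝓝[>] 0) = 1}

/-! ### Morphology

The dilation `{x | dist (x, A) < ε}` is `Metric.thickening ε A`; the distance to the empty set
is `∞`. -/

/-- The erosion `{x | dist (x, Aᶜ) ≥ ε}`. -/
def erosion (ε : ℝ) (A : Set X) : Set X := {x | ENNReal.ofReal ε ≤ Metric.infEDist x Aᶜ}

/-- The morphological closing: dilation followed by erosion. -/
def closing (ε : ℝ) (A : Set X) : Set X := erosion ε (Metric.thickening ε A)

/-- The morphological opening: erosion followed by dilation. -/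
def opening (ε : ℝ) (A : Set X) : Set X := Metric.thickening ε (erosion ε A)

/-- `ε` inner regularity relative to the metric. -/
def InnerRegularAt (ε : ℝ) (A : Set X) : Prop :=
  ∀ x ∈ frontier A, ∃ y : X, dist x y = ε ∧ Metric.ball y ε ⊆ A

/-- `ε` outer regularity relative to the metric. -/
def OuterRegularAt (ε : ℝ) (A : Set X) : Prop :=
  ∀ x ∈ frontier A, ∃ y : X, dist x y = ε ∧ Metric.ball y ε ⊆ Aᶜ

/-- Whenever a point has distance exactly `ε` to a closed set, this distance is attained. This
holds for every `ε` in a space whose closed bounded sets are compact, such as `ℝ^d`. -/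
def AttainsDistance (X : Type*) [MetricSpace X] (ε : ℝ) : Prop :=
  ∀ (x : X) (C : Set X), IsClosed C → Metric.infEDist x C = ENNReal.ofReal ε →
    ∃ y ∈ C, dist x y = ε

end

end AdvTraining

/-!
Up to `ν`-null sets the regularized objective is `m₀ (essThickening ν ε A) +
m₁ (essThickening ν ε Aᶜ)`, where `m_i = w_i ρ_i` and the essential dilation collects the points
whose `ε`-ball meets the set in positive `ν`-measure: the infimum in the perimeter is attained by
a representative built from the supports of `ν` restricted to `A` and `Aᶜ`. This functional is
submodular and lower semicontinuous along monotone sequences. Submodularity turns the tails of a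
fast minimizing sequence into monotone sequences that stay almost minimizing, so minimizers exist
without any compactness; they form a lattice closed under countable unions, and an exhaustion
yields a greatest one.

Local doubling at `ν`-almost every point gives a Vitali covering argument showing `A ⊆ A⁺` up to a
null set. The dilation of `cl_ε (A⁺)` is that of `A⁺`, so the adversarial risk of `cl_ε (A⁺)` is
at most the essential risk of `A`. Hence the closing of a greatest minimizer solves the
adversarial problem, and it is again a minimizer containing `A`, thus equal to `A` almost
everywhere. Exchanging the two classes and passing to complements turns minimal solutions into
maximal ones, and `op_ε (A⁻)` into the complement of `cl_ε ((Aᶜ)⁺)`.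
-/

namespace AdvTraining

noncomputable section

open MeasureTheory Set Filter
open scoped ENNReal NNReal Topology

/-! ### Minimizers of submodular set functions -/

section Minimizers

variable {α : Type*} [MeasurableSpace α] {F G : Set α → ℝ≥0∞} {ν : Measure α} {A B : Set α}

/-- `A` is measurable and minimizes the set function `F` among the measurable sets. -/
def IsMinimizer (F : Set α → ℝ≥0∞) (A : Set α) : Prop :=
  MeasurableSet A ∧ ∀ B, MeasurableSet B → F A ≤ F B

/-- `A` is a minimizer of `F` that contains all other minimizers up to `ν`-null sets. -/
def IsAEGreatestMinimizer (ν : Measure α) (F : Set α → ℝ≥0∞) (A : Set α) : Prop :=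
  IsMinimizer F A ∧ ∀ B, IsMinimizer F B → B ≤ᵐ[ν] A

/-- A submodular set function on the measurable sets that is lower semicontinuous along monotone
sequences. Both properties are self-dual under complements. They replace convexity and weak
lower semicontinuity in the direct method. -/
structure IsLSCSubmodular (F : Set α → ℝ≥0∞) : Prop where
  union_add_inter_le {A B : Set α} : MeasurableSet A → MeasurableSet B →
    F (A ∪ B) + F (A ∩ B) ≤ F A + F B
  iUnion_le_liminf {s : ℕ → Set α} : (∀ n, MeasurableSet (s n)) → Monotone s →
    F (⋃ n, s n) ≤ liminf (fun n => F (s n)) atTop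
  iInter_le_liminf {s : ℕ → Set α} : (∀ n, MeasurableSet (s n)) → Antitone s →
    F (⋂ n, s n) ≤ liminf (fun n => F (s n)) atTop

lemma isMinimizer_congr (h : ∀ A, MeasurableSet A → F A = G A) :
    IsMinimizer F A ↔ IsMinimizer G A :=
  and_congr_right fun hA => forall₂_congr fun B hB => by rw [h A hA, h B hB]

lemma isMinimizer_comp_compl : IsMinimizer (fun B => F Bᶜ) Aᶜ ↔ IsMinimizer F A :=
  ⟨fun h => ⟨h.1.of_compl, fun B hB => by simpa using h.2 Bᶜ hB.compl⟩,
    fun h => ⟨h.1.compl, fun B hB => by simpa using h.2 Bᶜ hB.compl⟩⟩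

lemma IsAEGreatestMinimizer.ae_eq (hA : IsAEGreatestMinimizer ν F A)
    (hB : IsAEGreatestMinimizer ν F B) : A =ᵐ[ν] B :=
  (hB.2 A hA.1).antisymm (hA.2 B hB.1)

namespace IsLSCSubmodular

lemma union_le_add (hF : IsLSCSubmodular F) {c a b : ℝ≥0∞}
    (hc : ∀ C, MeasurableSet C → c ≤ F C) (hA : MeasurableSet A) (hB : MeasurableSet B)
    (ha : F A ≤ c + a) (hb : F B ≤ c + b) : F (A ∪ B) ≤ c + (a + b) := by
  rcases eq_or_ne c ∞ with rfl | hc_top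
  · simp
  refine (ENNReal.add_le_add_iff_right hc_top).1 ?_
  calc F (A ∪ B) + c ≤ F (A ∪ B) + F (A ∩ B) := by gcongr; exact hc _ (hA.inter hB)
    _ ≤ F A + F B := hF.union_add_inter_le hA hB
    _ ≤ (c + a) + (c + b) := add_le_add ha hb
    _ = c + (a + b) + c := by ring

lemma iUnion_le_add_tsum (hF : IsLSCSubmodular F) {c : ℝ≥0∞}
    (hc : ∀ C, MeasurableSet C → c ≤ F C) {s : ℕ → Set α} {δ : ℕ → ℝ≥0∞}
    (hs : ∀ n, MeasurableSet (s n)) (hδ : ∀ n, F (s n) ≤ c + δ n) :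
    F (⋃ n, s n) ≤ c + ∑' n, δ n := by
  have hmeas (n : ℕ) : MeasurableSet (partialSups s n) := by
    rw [partialSups_eq_biUnion_range]
    exact Finset.measurableSet_biUnion _ fun i _ => hs i
  have hpartial (n : ℕ) : F (partialSups s n) ≤ c + ∑ i ∈ Finset.range (n + 1), δ i := by
    induction n with
    | zero => simpa using hδ 0
    | succ n ih =>
      rw [Finset.sum_range_succ]
      simpa using hF.union_le_add hc (hmeas n) (hs (n + 1)) ih (hδ (n + 1))
  calc F (⋃ n, s n) = F (⋃ n, partialSups s n) := congrArg F (iSup_partialSups_eq s).symm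
    _ ≤ liminf (fun n => F (partialSups s n)) atTop :=
      hF.iUnion_le_liminf hmeas (partialSups s).monotone
    _ ≤ liminf (fun _ : ℕ => c + ∑' n, δ n) atTop :=
      liminf_le_liminf (.of_forall fun n =>
        (hpartial n).trans (by gcongr; exact ENNReal.sum_le_tsum _))
    _ = c + ∑' n, δ n := liminf_const _

lemma isMinimizer_iUnion (hF : IsLSCSubmodular F) {s : ℕ → Set α}
    (hs : ∀ n, IsMinimizer F (s n)) : IsMinimizer F (⋃ n, s n) := by
  refine ⟨.iUnion fun n => (hs n).1, fun C hC => le_trans ?_ ((hs 0).2 C hC)⟩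
  simpa using hF.iUnion_le_add_tsum (δ := 0) (hs 0).2 (fun n => (hs n).1)
    fun n => by simpa using (hs n).2 _ (hs 0).1

lemma isMinimizer_union (hF : IsLSCSubmodular F) (hA : IsMinimizer F A) (hB : IsMinimizer F B) :
    IsMinimizer F (A ∪ B) := by
  refine ⟨hA.1.union hB.1, fun C hC => le_trans ?_ (hA.2 C hC)⟩
  simpa using hF.union_le_add (a := 0) (b := 0) hA.2 hA.1 hB.1 (by simp)
    (by simpa using hB.2 _ hA.1)

end IsLSCSubmodular

lemma exists_measurableSet_le_iInf_add (F : Set α → ℝ≥0∞) {δ : ℝ≥0∞} (hδ : δ ≠ 0) :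
    ∃ A, MeasurableSet A ∧ F A ≤ (⨅ (B : Set α) (_ : MeasurableSet B), F B) + δ := by
  set c := ⨅ (B : Set α) (_ : MeasurableSet B), F B
  rcases eq_or_ne c ∞ with hc_top | hc_top
  · exact ⟨∅, .empty, by simp [hc_top]⟩
  · obtain ⟨A, hA, hlt⟩ : ∃ A, ∃ _ : MeasurableSet A, F A < c + δ := by
      simpa only [c, iInf_lt_iff] using ENNReal.lt_add_right hc_top hδ
    exact ⟨A, hA, hlt.le⟩

/-- The direct method: with near-minimizers `s n` whose excesses `δ n` are summable, submodularity
bounds the excess of the tail unions `⋃ i, s (i + n)` by `∑' i, δ (i + n)`, so no compactness is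
needed to pass to the limit. -/
lemma IsLSCSubmodular.exists_isMinimizer (hF : IsLSCSubmodular F) : ∃ A, IsMinimizer F A := by
  set c := ⨅ (B : Set α) (_ : MeasurableSet B), F B
  have hc (B : Set α) (hB : MeasurableSet B) : c ≤ F B := iInf₂_le B hB
  obtain ⟨δ, hδpos, hδsum⟩ := ENNReal.exists_pos_sum_of_countable' one_ne_zero ℕ
  choose s hs hsδ using fun n => exists_measurableSet_le_iInf_add F (hδpos n).ne'
  let t (n : ℕ) : Set α := ⋃ i, s (i + n)
  have ht_meas (n : ℕ) : MeasurableSet (t n) := .iUnion fun i => hs (i + n)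
  have ht_anti : Antitone t := by
    refine antitone_nat_of_succ_le fun n => iUnion_subset fun i => ?_
    rw [← add_assoc, add_right_comm]
    exact subset_iUnion (fun i => s (i + n)) (i + 1)
  have ht (n : ℕ) : F (t n) ≤ c + ∑' i, δ (i + n) :=
    hF.iUnion_le_add_tsum hc (fun i => hs (i + n)) fun i => hsδ (i + n)
  have htail : Tendsto (fun n => c + ∑' i, δ (i + n)) atTop (𝓝 c) := by
    simpa using (ENNReal.tendsto_sum_nat_add δ (hδsum.trans ENNReal.one_lt_top).ne).const_add c
  refine ⟨⋂ n, t n, .iInter ht_meas, fun B hB => ?_⟩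
  calc F (⋂ n, t n) ≤ liminf (fun n => F (t n)) atTop := hF.iInter_le_liminf ht_meas ht_anti
    _ ≤ liminf (fun n => c + ∑' i, δ (i + n)) atTop := liminf_le_liminf (.of_forall ht)
    _ = c := htail.liminf_eq
    _ ≤ F B := hc B hB

/-- Exhaustion: the union of a sequence in `P` whose measures tend to the supremum. -/
lemma exists_ae_greatest_of_iUnion_mem [SFinite ν] {P : Set (Set α)} (hP : P.Nonempty)
    (hP_meas : ∀ A ∈ P, MeasurableSet A)
    (hP_iUnion : ∀ s : ℕ → Set α, (∀ n, s n ∈ P) → ⋃ n, s n ∈ P) :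
    ∃ A ∈ P, ∀ B ∈ P, B ≤ᵐ[ν] A := by
  let m := ν.toFinite
  obtain ⟨u, -, hu_tendsto, hu⟩ :=
    exists_seq_tendsto_sSup (hP.image m) (OrderTop.bddAbove (m '' P))
  choose s hsP hsu using hu
  have hsup : sSup (m '' P) ≤ m (⋃ n, s n) :=
    le_of_tendsto' hu_tendsto fun n => (hsu n).symm.le.trans (measure_mono (subset_iUnion s n))
  refine ⟨⋃ n, s n, hP_iUnion s hsP, fun B hB => ?_⟩
  have hunion : B ∪ ⋃ n, s n ∈ P := by
    have := hP_iUnion (fun n => Nat.casesOn n B s) (by rintro (_ | n); exacts [hB, hsP n])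
    rwa [← union_iUnion_nat_succ] at this
  have hle : m (B ∪ ⋃ n, s n) ≤ m (⋃ n, s n) := (le_sSup (mem_image_of_mem m hunion)).trans hsup
  have hae : (⋃ n, s n : Set α) =ᵐ[m] (B ∪ ⋃ n, s n : Set α) :=
    ae_eq_of_subset_of_measure_ge subset_union_right hle
      (MeasurableSet.iUnion fun n => hP_meas _ (hsP n)).nullMeasurableSet (measure_ne_top m _)
  exact (subset_union_left.eventuallyLE.trans hae.symm.le).filter_mono
    (absolutelyContinuous_toFinite ν).ae_le

lemma IsLSCSubmodular.exists_isAEGreatestMinimizer [SFinite ν] (hF : IsLSCSubmodular F) :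
    ∃ A, IsAEGreatestMinimizer ν F A :=
  exists_ae_greatest_of_iUnion_mem (P := {A | IsMinimizer F A}) hF.exists_isMinimizer
    (fun _ hA => hA.1) fun _ hs => hF.isMinimizer_iUnion hs

lemma IsLSCSubmodular.isAEGreatestMinimizer_iff (hF : IsLSCSubmodular F) :
    IsAEGreatestMinimizer ν F A ↔
      IsMinimizer F A ∧ ∀ B, IsMinimizer F B → A ≤ᵐ[ν] B → A =ᵐ[ν] B := by
  refine and_congr_right fun hA => ⟨fun h B hB hAB => hAB.antisymm (h B hB), fun h B hB => ?_⟩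
  have hAB : A =ᵐ[ν] (A ∪ B : Set α) :=
    h (A ∪ B) (hF.isMinimizer_union hA hB) subset_union_left.eventuallyLE
  exact (subset_union_right (s := A)).eventuallyLE.trans hAB.symm.le

end Minimizers

/-! ### Morphology -/

section Morphology

variable {X : Type*} [MetricSpace X] {ε : ℝ} {A B : Set X} {x : X}

lemma mem_erosion_iff : x ∈ erosion ε A ↔ Metric.ball x ε ⊆ A := by
  simp only [erosion, mem_ofPred_eq, Metric.le_infEDist, mem_compl_iff, subset_def,
    Metric.mem_ball']
  refine forall_congr' fun y => ?_
  rw [not_imp_comm, not_le, edist_lt_ofReal]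

lemma compl_erosion (ε : ℝ) (A : Set X) : (erosion ε A)ᶜ = Metric.thickening ε Aᶜ := by
  ext x
  simp [erosion, Metric.mem_thickening_iff_infEDist_lt]

lemma gc_thickening_erosion (ε : ℝ) :
    GaloisConnection (Metric.thickening ε : Set X → Set X) (erosion ε) := by
  intro A B
  simp only [Metric.thickening_eq_biUnion_ball, iUnion₂_subset_iff, subset_def (s := A),
    mem_erosion_iff]

lemma isClosed_erosion (ε : ℝ) (A : Set X) : IsClosed (erosion ε A) :=
  isClosed_le continuous_const Metric.continuous_infEDist

lemma subset_closing (ε : ℝ) (A : Set X) : A ⊆ closing ε A :=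
  (gc_thickening_erosion ε).le_u_l A

lemma opening_subset (ε : ℝ) (A : Set X) : opening ε A ⊆ A :=
  (gc_thickening_erosion ε).l_u_le A

lemma thickening_closing (ε : ℝ) (A : Set X) :
    Metric.thickening ε (closing ε A) = Metric.thickening ε A :=
  (gc_thickening_erosion ε).l_u_l_eq_l A

lemma isClosed_closing (ε : ℝ) (A : Set X) : IsClosed (closing ε A) :=
  isClosed_erosion ε _

lemma compl_closing (ε : ℝ) (A : Set X) : (closing ε A)ᶜ = opening ε Aᶜ := by
  rw [closing, opening, compl_erosion, ← compl_compl (erosion ε Aᶜ), compl_erosion, compl_compl]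

lemma AttainsDistance.outerRegularAt_closing (h : AttainsDistance X ε) (A : Set X) :
    OuterRegularAt ε (closing ε A) := by
  intro x hx
  obtain ⟨y, hy, hxy⟩ := h x _ Metric.isOpen_thickening.isClosed_compl
    (frontier_le_subset_eq continuous_const Metric.continuous_infEDist hx).symm
  exact ⟨y, hxy, (Metric.ball_subset_thickening hy ε).trans_eq (compl_erosion ε _).symm⟩

lemma OuterRegularAt.innerRegularAt_compl (h : OuterRegularAt ε A) : InnerRegularAt ε Aᶜ :=
  fun x hx => h x (by rwa [frontier_compl] at hx)

end Morphology

/-! ### Essential dilations -/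

section EssThickening

variable {X : Type*} [PseudoMetricSpace X] [MeasurableSpace X]
variable {ν m : Measure X} {ε : ℝ} {A B : Set X}

/-- The essential dilation of `A`: the points whose open `ε`-ball meets `A` in a set of positive
`ν`-measure, i.e. at which the `ν`-essential supremum of `1_A` over the ball is `1`. -/
def essThickening (ν : Measure X) (ε : ℝ) (A : Set X) : Set X :=
  {x | 0 < ν (Metric.ball x ε ∩ A)}

lemma essThickening_subset_thickening (ν : Measure X) (ε : ℝ) (A : Set X) :
    essThickening ν ε A ⊆ Metric.thickening ε A := by
  intro x hx
  obtain ⟨y, hxy, hyA⟩ := nonempty_of_measure_ne_zero hx.ne'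
  exact Metric.mem_thickening_iff.2 ⟨y, hyA, Metric.mem_ball'.1 hxy⟩

lemma essThickening_mono_ae (h : A ≤ᵐ[ν] B) : essThickening ν ε A ⊆ essThickening ν ε B :=
  fun _ hx => hx.trans_le (measure_mono_ae (EventuallyLE.rfl.inter h))

lemma essThickening_congr_ae (h : A =ᵐ[ν] B) : essThickening ν ε A = essThickening ν ε B :=
  (essThickening_mono_ae h.le).antisymm (essThickening_mono_ae h.symm.le)

lemma essThickening_mono (h : A ⊆ B) : essThickening ν ε A ⊆ essThickening ν ε B :=
  essThickening_mono_ae h.eventuallyLE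

lemma essThickening_iUnion {ι : Sort*} [Countable ι] (s : ι → Set X) :
    essThickening ν ε (⋃ i, s i) = ⋃ i, essThickening ν ε (s i) := by
  ext x
  simp only [essThickening, mem_ofPred_eq, inter_iUnion, mem_iUnion, pos_iff_ne_zero, ne_eq,
    measure_iUnion_null_iff, not_forall]

lemma essThickening_union (ν : Measure X) (ε : ℝ) (A B : Set X) :
    essThickening ν ε (A ∪ B) = essThickening ν ε A ∪ essThickening ν ε B := by
  simp only [union_eq_iUnion, essThickening_iUnion, Bool.cond_eq_ite, apply_ite]

variable [OpensMeasurableSpace X] [SecondCountableTopology X]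

lemma essThickening_eq_thickening_support (ν : Measure X) (ε : ℝ) (A : Set X) :
    essThickening ν ε A = Metric.thickening ε (ν.restrict A).support := by
  ext x
  rw [essThickening, mem_ofPred_eq, ← Measure.restrict_apply Metric.isOpen_ball.measurableSet,
    Metric.mem_thickening_iff]
  constructor
  · intro h
    obtain ⟨y, hxy, hy⟩ := Measure.nonempty_inter_support_of_pos h
    exact ⟨y, hy, Metric.mem_ball'.1 hxy⟩
  · rintro ⟨y, hy, hxy⟩
    exact (Measure.mem_support_iff_forall y).1 hy _
      (Metric.isOpen_ball.mem_nhds (Metric.mem_ball'.2 hxy))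

lemma isOpen_essThickening (ν : Measure X) (ε : ℝ) (A : Set X) :
    IsOpen (essThickening ν ε A) := by
  rw [essThickening_eq_thickening_support]
  exact Metric.isOpen_thickening

lemma measure_thickening_le_essThickening (hm : ∀ᵐ x ∂m, Metric.ball x ε ⊆ ν.support)
    (hB : B ∩ ν.support ⊆ (ν.restrict A).support) :
    m (Metric.thickening ε B) ≤ m (essThickening ν ε A) := by
  rw [essThickening_eq_thickening_support]
  refine measure_mono_ae ?_
  filter_upwards [hm] with x hx hxB
  obtain ⟨y, hyB, hxy⟩ := Metric.mem_thickening_iff.1 hxB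
  exact Metric.mem_thickening_iff.2 ⟨y, hB ⟨hyB, hx (Metric.mem_ball'.2 hxy)⟩, hxy⟩

lemma measure_essThickening_union_add_inter_le (ν m : Measure X) (ε : ℝ) (A B : Set X) :
    m (essThickening ν ε (A ∪ B)) + m (essThickening ν ε (A ∩ B)) ≤
      m (essThickening ν ε A) + m (essThickening ν ε B) := by
  rw [essThickening_union,
    ← measure_union_add_inter (essThickening ν ε A) (isOpen_essThickening ν ε B).measurableSet]
  gcongr
  exact subset_inter (essThickening_mono inter_subset_left) (essThickening_mono inter_subset_right)

end EssThickening

/-! ### The risk of a classifier in terms of dilations -/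

section ThickeningRisk

variable {X : Type*} [PseudoMetricSpace X] [MeasurableSpace X]
variable {ν m₀ m₁ : Measure X} {ε : ℝ} {A B : Set X}

/-- The adversarial risk of the classifier `1_A`, when `m₀` and `m₁` are the (unnormalized)
distributions of the two classes: a point of class `0` is misclassified under attack if it lies in
the dilation of `A`, a point of class `1` if it lies in the dilation of `Aᶜ`. -/
def thickeningRisk (m₀ m₁ : Measure X) (ε : ℝ) (A : Set X) : ℝ≥0∞ :=
  m₀ (Metric.thickening ε A) + m₁ (Metric.thickening ε Aᶜ)

/-- The variant of `thickeningRisk` with essential dilations, which depends on `A` only up to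
`ν`-null sets. -/
def essThickeningRisk (ν m₀ m₁ : Measure X) (ε : ℝ) (A : Set X) : ℝ≥0∞ :=
  m₀ (essThickening ν ε A) + m₁ (essThickening ν ε Aᶜ)

lemma thickeningRisk_compl (m₀ m₁ : Measure X) (ε : ℝ) (A : Set X) :
    thickeningRisk m₀ m₁ ε Aᶜ = thickeningRisk m₁ m₀ ε A := by
  rw [thickeningRisk, thickeningRisk, compl_compl, add_comm]

lemma essThickeningRisk_compl (ν m₀ m₁ : Measure X) (ε : ℝ) (A : Set X) :
    essThickeningRisk ν m₀ m₁ ε Aᶜ = essThickeningRisk ν m₁ m₀ ε A := by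
  rw [essThickeningRisk, essThickeningRisk, compl_compl, add_comm]

lemma essThickeningRisk_congr_ae (h : A =ᵐ[ν] B) :
    essThickeningRisk ν m₀ m₁ ε A = essThickeningRisk ν m₀ m₁ ε B := by
  rw [essThickeningRisk, essThickeningRisk, essThickening_congr_ae h,
    essThickening_congr_ae h.compl]

lemma essThickeningRisk_le_thickeningRisk (ν m₀ m₁ : Measure X) (ε : ℝ) (A : Set X) :
    essThickeningRisk ν m₀ m₁ ε A ≤ thickeningRisk m₀ m₁ ε A := by
  unfold essThickeningRisk thickeningRisk
  gcongr <;> exact essThickening_subset_thickening ν ε _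

lemma isMinimizer_essThickeningRisk_compl :
    IsMinimizer (essThickeningRisk ν m₁ m₀ ε) Aᶜ ↔ IsMinimizer (essThickeningRisk ν m₀ m₁ ε) A := by
  simpa only [essThickeningRisk_compl] using
    isMinimizer_comp_compl (F := essThickeningRisk ν m₀ m₁ ε) (A := A)

lemma isMinimizer_thickeningRisk_compl :
    IsMinimizer (thickeningRisk m₁ m₀ ε) Aᶜ ↔ IsMinimizer (thickeningRisk m₀ m₁ ε) A := by
  simpa only [thickeningRisk_compl] using
    isMinimizer_comp_compl (F := thickeningRisk m₀ m₁ ε) (A := A)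

lemma essThickeningRisk_iUnion_le_liminf {s : ℕ → Set X} (hs : Monotone s) :
    essThickeningRisk ν m₀ m₁ ε (⋃ n, s n) ≤
      liminf (fun n => essThickeningRisk ν m₀ m₁ ε (s n)) atTop := by
  have hmono : Monotone fun n => essThickening ν ε (s n) :=
    fun i j hij => essThickening_mono (hs hij)
  have hlim : Tendsto (fun n => m₀ (essThickening ν ε (s n)) + m₁ (essThickening ν ε (⋃ n, s n)ᶜ))
      atTop (𝓝 (essThickeningRisk ν m₀ m₁ ε (⋃ n, s n))) := by
    rw [essThickeningRisk, essThickening_iUnion]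
    exact (tendsto_measure_iUnion_atTop hmono).add_const _
  rw [← hlim.liminf_eq]
  refine liminf_le_liminf (.of_forall fun n => ?_)
  unfold essThickeningRisk
  gcongr
  exact essThickening_mono (compl_subset_compl.2 (subset_iUnion s n))

lemma isLSCSubmodular_essThickeningRisk [OpensMeasurableSpace X] [SecondCountableTopology X]
    (ν m₀ m₁ : Measure X) (ε : ℝ) : IsLSCSubmodular (essThickeningRisk ν m₀ m₁ ε) where
  union_add_inter_le {A B} _ _ := by
    have h₀ := measure_essThickening_union_add_inter_le ν m₀ ε A B
    have h₁ := measure_essThickening_union_add_inter_le ν m₁ ε Aᶜ Bᶜ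
    rw [← compl_inter, ← compl_union] at h₁
    unfold essThickeningRisk
    rw [add_add_add_comm, add_add_add_comm (m₀ (essThickening ν ε A)),
      add_comm (m₁ (essThickening ν ε (A ∪ B)ᶜ))]
    exact add_le_add h₀ h₁
  iUnion_le_liminf _ hs := essThickeningRisk_iUnion_le_liminf hs
  iInter_le_liminf {s} _ hs := by
    simpa only [← compl_iInter, essThickeningRisk_compl] using
      essThickeningRisk_iUnion_le_liminf (ν := ν) (m₀ := m₁) (m₁ := m₀) (ε := ε)
        fun i j hij => compl_subset_compl.2 (hs hij)

end ThickeningRisk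

/-! ### Points of positive upper density -/

section Density

lemma eventually_le_mul_of_limsup_div_lt {ι : Type*} {l : Filter ι} {f g : ι → ℝ≥0∞} {c : ℝ≥0∞}
    (h : limsup (fun i => f i / g i) l < c) (hc : c ≠ ∞) : ∀ᶠ i in l, f i ≤ c * g i :=
  (eventually_lt_of_limsup_lt h).mono fun _ hi =>
    (ENNReal.div_le_iff_le_mul (.inr hc) (.inr (ne_bot_of_gt h))).1 hi.le

variable {X : Type*} [PseudoMetricSpace X] [MeasurableSpace X]
variable {ν : Measure X} {A B S U : Set X} {x : X} {C : ℝ≥0} {δ : ℝ≥0∞}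

/-- The upper density of `A` at `x` with respect to `ν`. -/
def upperDensity (ν : Measure X) (A : Set X) (x : X) : ℝ≥0∞ :=
  limsup (fun r : ℝ => ν (Metric.ball x r ∩ A) / ν (Metric.ball x r)) (𝓝[>] 0)

lemma upperDensity_mono_ae (h : A ≤ᵐ[ν] B) (x : X) : upperDensity ν A x ≤ upperDensity ν B x :=
  limsup_le_limsup <| .of_forall fun _ =>
    ENNReal.div_le_div_right (measure_mono_ae (EventuallyLE.rfl.inter h)) _

lemma eventually_measure_closedBall_three_mul_le
    (hC : ∀ᶠ r : ℝ in 𝓝[>] 0, ν (Metric.ball x (2 * r)) ≤ C * ν (Metric.ball x r)) :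
    ∀ᶠ r : ℝ in 𝓝[>] 0, ν (Metric.closedBall x (3 * r)) ≤ C ^ 2 * ν (Metric.closedBall x r) := by
  filter_upwards [hC, eventually_nhdsGT_zero_mul_left two_pos hC, self_mem_nhdsWithin]
    with r hr hr2 (hr0 : 0 < r)
  calc ν (Metric.closedBall x (3 * r)) ≤ ν (Metric.ball x (2 * (2 * r))) :=
        measure_mono (Metric.closedBall_subset_ball (by linarith))
    _ ≤ C * (C * ν (Metric.ball x r)) := hr2.trans (by gcongr)
    _ ≤ C ^ 2 * ν (Metric.closedBall x r) := by
        rw [← mul_assoc, ← sq]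
        gcongr
        exact Metric.ball_subset_closedBall

lemma eventually_measure_closedBall_inter_le
    (hC : ∀ᶠ r : ℝ in 𝓝[>] 0, ν (Metric.ball x (2 * r)) ≤ C * ν (Metric.ball x r))
    (hA : upperDensity ν A x < δ) (hδ : δ ≠ ∞) :
    ∀ᶠ r : ℝ in 𝓝[>] 0, ν (Metric.closedBall x r ∩ A) ≤ δ * C * ν (Metric.closedBall x r) := by
  filter_upwards [hC, eventually_nhdsGT_zero_mul_left two_pos
    (eventually_le_mul_of_limsup_div_lt hA hδ), self_mem_nhdsWithin] with r hr hr2 (hr0 : 0 < r)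
  calc ν (Metric.closedBall x r ∩ A) ≤ ν (Metric.ball x (2 * r) ∩ A) := by
        gcongr
        exact Metric.closedBall_subset_ball (by linarith)
    _ ≤ δ * (C * ν (Metric.ball x r)) := hr2.trans (by gcongr)
    _ ≤ δ * C * ν (Metric.closedBall x r) := by
        rw [← mul_assoc]
        gcongr
        exact Metric.ball_subset_closedBall

variable [OpensMeasurableSpace X]

lemma mem_support_restrict_of_upperDensity_pos (hx : 0 < upperDensity ν A x) :
    x ∈ (ν.restrict A).support := by
  refine Metric.nhds_basis_ball.mem_measureSupport.2 fun R hR => pos_iff_ne_zero.2 fun hzero => ?_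
  rw [Measure.restrict_apply Metric.isOpen_ball.measurableSet] at hzero
  have hev : (fun r : ℝ => ν (Metric.ball x r ∩ A) / ν (Metric.ball x r)) =ᶠ[𝓝[>] 0]
      fun _ => 0 := by
    filter_upwards [Ioo_mem_nhdsGT hR] with r hr
    rw [measure_mono_null (inter_subset_inter_left A (Metric.ball_subset_ball hr.2.le)) hzero,
      ENNReal.zero_div]
  rw [upperDensity, limsup_congr hev, limsup_const] at hx
  exact hx.false

variable [SecondCountableTopology X] [IsLocallyFiniteMeasure ν]

lemma measure_inter_le_mul_of_frequently_closedBall (hU : IsOpen U) (hSU : S ⊆ U)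
    (hS : ∀ x ∈ S, ∃ᶠ r : ℝ in 𝓝[>] 0,
      ν (Metric.closedBall x (3 * r)) ≤ C * ν (Metric.closedBall x r) ∧
      ν (Metric.closedBall x r ∩ A) ≤ δ * ν (Metric.closedBall x r)) :
    ν (S ∩ A) ≤ δ * ν U := by
  let ball (a : X × ℝ) : Set X := Metric.closedBall a.1 a.2
  let t : Set (X × ℝ) := {a | 0 < a.2 ∧ ball a ⊆ U ∧
    ν (Metric.closedBall a.1 (3 * a.2)) ≤ C * ν (ball a) ∧ ν (ball a ∩ A) ≤ δ * ν (ball a)}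
  have hfine (x : X) (hx : x ∈ S) : ∃ᶠ r in 𝓝[>] 0, ∃ a ∈ t, a.2 = r ∧ a.1 = x := by
    have hsub : ∀ᶠ r : ℝ in 𝓝[>] 0, 0 < r ∧ Metric.closedBall x r ⊆ U :=
      eventually_mem_nhdsWithin.and <| eventually_nhdsWithin_of_eventually_nhds <|
        eventually_closedBall_subset (hU.mem_nhds (hSU hx))
    exact ((hS x hx).and_eventually hsub).mono fun r hr =>
      ⟨(x, r), ⟨hr.2.1, hr.2.2, hr.1⟩, rfl, rfl⟩
  obtain ⟨u, hut, hu, hdisj, hcov⟩ := Vitali.exists_disjoint_covering_ae' ν S t C Prod.snd Prod.fst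
    ball (fun _ _ => Subset.rfl) (fun a ha => ha.2.2.1)
    (fun a ha => ⟨a.1, Metric.ball_subset_interior_closedBall (Metric.mem_ball_self ha.1)⟩)
    (fun _ _ => Metric.isClosed_closedBall) hfine
  have hScov : S ≤ᵐ[ν] (⋃ a ∈ u, ball a : Set X) := ae_le_set.2 hcov
  calc ν (S ∩ A) ≤ ν ((⋃ a ∈ u, ball a) ∩ A) := measure_mono_ae (hScov.inter EventuallyLE.rfl)
    _ ≤ ∑' a : u, ν (ball a ∩ A) := by
        rw [iUnion₂_inter]
        exact measure_biUnion_le ν hu _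
    _ ≤ ∑' a : u, δ * ν (ball a) := ENNReal.tsum_le_tsum fun a => (hut a.2).2.2.2
    _ = δ * ν (⋃ a ∈ u, ball a) := by
        rw [ENNReal.tsum_mul_left,
          measure_biUnion hu hdisj fun _ _ => Metric.isClosed_closedBall.measurableSet]
    _ ≤ δ * ν U := by
        gcongr
        exact iUnion₂_subset fun a ha => (hut ha).2.1

lemma measure_inter_eq_zero_of_upperDensity_eq_zero
    (hC : ∀ x ∈ S, ∀ᶠ r : ℝ in 𝓝[>] 0, ν (Metric.ball x (2 * r)) ≤ C * ν (Metric.ball x r))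
    (hA : ∀ x ∈ S, upperDensity ν A x = 0) : ν (S ∩ A) = 0 := by
  refine measure_null_of_locally_null _ fun x _ => ?_
  obtain ⟨U, hxU, hU, hνU⟩ := ν.exists_isOpen_measure_lt_top x
  refine ⟨S ∩ U ∩ A, ?_, ?_⟩
  · rw [inter_right_comm]
    exact inter_mem_nhdsWithin _ (hU.mem_nhds hxU)
  have hbound : ∀ᶠ δ : ℝ≥0∞ in 𝓝[>] 0, ν (S ∩ U ∩ A) ≤ δ * (C * ν U) := by
    filter_upwards [Ioo_mem_nhdsGT one_pos] with δ hδ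
    rw [← mul_assoc]
    refine measure_inter_le_mul_of_frequently_closedBall (C := C ^ 2) hU inter_subset_right
      fun y hy => ?_
    have hdoubling := eventually_measure_closedBall_three_mul_le (hC y hy.1)
    have hdensity := eventually_measure_closedBall_inter_le (hC y hy.1)
      ((hA y hy.1).trans_lt hδ.1) (hδ.2.trans ENNReal.one_lt_top).ne
    exact_mod_cast (hdoubling.and hdensity).frequently
  have hlim : Tendsto (fun δ : ℝ≥0∞ => δ * (C * ν U)) (𝓝[>] 0) (𝓝 0) :=
    ((ENNReal.continuous_mul_const (ENNReal.mul_ne_top ENNReal.coe_ne_top hνU.ne)).tendsto' 0 0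
      (zero_mul _)).mono_left nhdsWithin_le_nhds
  exact nonpos_iff_eq_zero.1 (ge_of_tendsto hlim hbound)

lemma ae_upperDensity_pos_of_mem (hν : ∀ᵐ x ∂ν,
      limsup (fun r : ℝ => ν (Metric.ball x (2 * r)) / ν (Metric.ball x r)) (𝓝[>] 0) < ∞)
    (A : Set X) : ∀ᵐ x ∂ν, x ∈ A → 0 < upperDensity ν A x := by
  let S (n : ℕ) : Set X := {x | upperDensity ν A x = 0 ∧
    limsup (fun r : ℝ => ν (Metric.ball x (2 * r)) / ν (Metric.ball x r)) (𝓝[>] 0) < n}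
  have hS (n : ℕ) : ν (S n ∩ A) = 0 :=
    measure_inter_eq_zero_of_upperDensity_eq_zero (C := n)
      (fun x hx => by
        simpa using eventually_le_mul_of_limsup_div_lt hx.2 (ENNReal.natCast_ne_top n))
      fun x hx => hx.1
  filter_upwards [hν, ae_all_iff.2 fun n => measure_eq_zero_iff_ae_notMem.1 (hS n)]
    with x hx hxS hxA
  obtain ⟨n, hn⟩ := ENNReal.exists_nat_gt hx.ne
  exact pos_iff_ne_zero.2 fun hzero => hxS n ⟨⟨hzero, hn⟩, hxA⟩

end Density

/-! ### Representatives -/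

section Representatives

lemma exists_ae_eq_thickeningRisk_le {X : Type*} [PseudoMetricSpace X] [MeasurableSpace X]
    [OpensMeasurableSpace X] [SecondCountableTopology X] {ν m₀ : Measure X} {ε : ℝ} {A : Set X}
    (h₀ : ∀ᵐ x ∂m₀, Metric.ball x ε ⊆ ν.support) (m₁ : Measure X) (hA : MeasurableSet A) :
    ∃ B, MeasurableSet B ∧ A =ᵐ[ν] B ∧
      thickeningRisk m₀ m₁ ε B ≤ essThickeningRisk ν m₀ m₁ ε A := by
  let S := (ν.restrict A).support
  let T := (ν.restrict Aᶜ).support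
  have hST : S ∪ T = ν.support := by
    rw [← Measure.support_add, Measure.restrict_add_restrict_compl hA]
  have hAS : ∀ᵐ x ∂ν, x ∈ A → x ∈ S := ae_imp_of_ae_restrict Measure.support_mem_ae
  have hAT : ∀ᵐ x ∂ν, x ∈ Aᶜ → x ∈ T := ae_imp_of_ae_restrict Measure.support_mem_ae
  refine ⟨A ∩ S ∪ Tᶜ, (hA.inter Measure.isClosed_support.measurableSet).union
    Measure.isClosed_support.measurableSet.compl, ?_, add_le_add ?_ ?_⟩
  · refine eventuallyEq_set.2 ?_
    filter_upwards [hAS, hAT] with x hxS hxT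
    simp only [mem_union, mem_inter_iff, mem_compl_iff] at hxT ⊢
    tauto
  · refine measure_thickening_le_essThickening h₀ ?_
    rintro x ⟨hx | hxT, hxν⟩
    · exact hx.2
    · exact (hST.ge hxν).resolve_right hxT
  · rw [essThickening_eq_thickening_support]
    gcongr
    exact Metric.thickening_subset_of_subset ε (compl_subset_comm.1 subset_union_right)

variable {X : Type*} [MetricSpace X] [MeasurableSpace X]
variable {ν m₀ m₁ : Measure X} {ε : ℝ} {A B : Set X}

lemma upperRep_mono_ae (h : A ≤ᵐ[ν] B) : upperRep ν A ⊆ upperRep ν B :=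
  fun x hx hxν => (hx hxν).trans_le (upperDensity_mono_ae h x)

lemma upperRep_congr_ae (h : A =ᵐ[ν] B) : upperRep ν A = upperRep ν B :=
  (upperRep_mono_ae h.le).antisymm (upperRep_mono_ae h.symm.le)

lemma lowerRep_subset_upperRep (ν : Measure X) (A : Set X) : lowerRep ν A ⊆ upperRep ν A :=
  fun _ hx _ => (zero_lt_one.trans_eq hx.2.symm).trans_le liminf_le_limsup

lemma eventually_measure_ball_inter_div_eq [IsLocallyFiniteMeasure ν] (hA : MeasurableSet A) {x : X}
    (hx : x ∈ ν.support) : ∀ᶠ r : ℝ in 𝓝[>] 0, ν (Metric.ball x r ∩ A) / ν (Metric.ball x r) =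
      1 - ν (Metric.ball x r ∩ Aᶜ) / ν (Metric.ball x r) := by
  obtain ⟨R, hR, hfin⟩ := (ν.finiteAt_nhds x).exists_mem_basis Metric.nhds_basis_ball
  filter_upwards [Ioo_mem_nhdsGT hR] with r hr
  have hpos : ν (Metric.ball x r) ≠ 0 :=
    ((Measure.mem_support_iff_forall x).1 hx _ (Metric.ball_mem_nhds x hr.1)).ne'
  have htop : ν (Metric.ball x r) ≠ ∞ := measure_ne_top_of_subset (Metric.ball_subset_ball hr.2.le)
    hfin.ne
  refine ENNReal.eq_sub_of_add_eq (ENNReal.div_ne_top (measure_ne_top_of_subset inter_subset_left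
    htop) hpos) ?_
  rw [← ENNReal.add_div, ← sdiff_eq, measure_inter_add_sdiff _ hA, ENNReal.div_self hpos htop]

lemma lowerRep_eq_compl_upperRep_compl [IsLocallyFiniteMeasure ν] (hA : MeasurableSet A) :
    lowerRep ν A = (upperRep ν Aᶜ)ᶜ := by
  ext x
  simp only [lowerRep, upperRep, mem_ofPred_eq, mem_compl_iff, Classical.not_imp, not_lt,
    nonpos_iff_eq_zero]
  refine and_congr_right fun hx => ?_
  rw [liminf_congr (eventually_measure_ball_inter_div_eq hA hx),
    ENNReal.liminf_const_sub _ _ ENNReal.one_ne_top]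
  refine ⟨fun h => ?_, fun h => by rw [h, tsub_zero]⟩
  by_contra hL
  exact (ENNReal.sub_lt_self ENNReal.one_ne_top one_ne_zero hL).ne h

lemma opening_lowerRep [IsLocallyFiniteMeasure ν] (hA : MeasurableSet A) :
    opening ε (lowerRep ν A) = (closing ε (upperRep ν Aᶜ))ᶜ := by
  rw [lowerRep_eq_compl_upperRep_compl hA, compl_closing]

lemma opening_lowerRep_subset_closing_upperRep (ε : ℝ) (h : A ≤ᵐ[ν] B) :
    opening ε (lowerRep ν A) ⊆ closing ε (upperRep ν B) :=
  calc opening ε (lowerRep ν A) ⊆ lowerRep ν A := opening_subset ε _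
    _ ⊆ upperRep ν A := lowerRep_subset_upperRep ν A
    _ ⊆ upperRep ν B := upperRep_mono_ae h
    _ ⊆ closing ε (upperRep ν B) := subset_closing ε _

variable [OpensMeasurableSpace X] [SecondCountableTopology X]

lemma ae_le_upperRep [IsLocallyFiniteMeasure ν] (hν : ∀ᵐ x ∂ν,
      limsup (fun r : ℝ => ν (Metric.ball x (2 * r)) / ν (Metric.ball x r)) (𝓝[>] 0) < ∞)
    (A : Set X) : A ≤ᵐ[ν] upperRep ν A :=
  (ae_upperDensity_pos_of_mem hν A).mono fun _ hx hxA _ => hx hxA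

lemma thickeningRisk_closing_upperRep_le
    (h₀ : ∀ᵐ x ∂m₀, Metric.ball x ε ⊆ ν.support) (h₁ : ∀ᵐ x ∂m₁, Metric.ball x ε ⊆ ν.support)
    (hA : A ≤ᵐ[ν] upperRep ν A) :
    thickeningRisk m₀ m₁ ε (closing ε (upperRep ν A)) ≤ essThickeningRisk ν m₀ m₁ ε A := by
  refine add_le_add ?_ (measure_thickening_le_essThickening h₁ ?_)
  · rw [thickening_closing]
    exact measure_thickening_le_essThickening h₀ fun x hx =>
      mem_support_restrict_of_upperDensity_pos (hx.1 hx.2)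
  · have hAC : A ≤ᵐ[ν] closing ε (upperRep ν A) :=
      hA.trans (subset_closing ε (upperRep ν A)).eventuallyLE
    calc (closing ε (upperRep ν A))ᶜ ∩ ν.support
        = interior (closing ε (upperRep ν A))ᶜ ∩ ν.support := by
          rw [(isClosed_closing ε (upperRep ν A)).isOpen_compl.interior_eq]
      _ ⊆ (ν.restrict (closing ε (upperRep ν A))ᶜ).support := Measure.interior_inter_support
      _ ⊆ (ν.restrict Aᶜ).support := Measure.support_mono (Measure.restrict_mono_ae hAC.compl)

end Representatives

/-! ### Indicator functions and the zero-one loss -/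

section Indicator

variable {X : Type*}

lemma ind_sub_ind (A B : Set X) (x : X) : ind A x - ind B x = ind (A \ B) x := by
  by_cases hA : x ∈ A <;> by_cases hB : x ∈ B <;> simp [ind, hA, hB]

lemma loss_zero (A : Set X) (x : X) : loss A x 0 = ind A x := by
  by_cases hA : x ∈ A <;> simp [loss, ind, hA]

lemma loss_one (A : Set X) (x : X) : loss A x 1 = ind Aᶜ x := by
  by_cases hA : x ∈ A <;> simp [loss, ind, hA]

lemma measurable_ind [MeasurableSpace X] {A : Set X} (hA : MeasurableSet A) :
    Measurable (ind A) :=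
  measurable_one.indicator hA

lemma lintegral_ind [MeasurableSpace X] {A : Set X} (hA : MeasurableSet A) (m : Measure X) :
    ∫⁻ x, ind A x ∂m = m A :=
  lintegral_indicator_one hA

variable [MetricSpace X] {ε : ℝ}

lemma iSup_ball_ind (ε : ℝ) (A : Set X) (x : X) :
    ⨆ x' ∈ Metric.ball x ε, ind A x' = ind (Metric.thickening ε A) x := by
  by_cases hx : x ∈ Metric.thickening ε A
  · obtain ⟨y, hyA, hxy⟩ := Metric.mem_thickening_iff.1 hx
    refine le_antisymm (iSup₂_le fun z _ => ?_) (le_iSup₂_of_le y (Metric.mem_ball'.2 hxy) ?_)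
    · rw [ind, ind, indicator_of_mem hx]
      exact indicator_le_self' (fun _ _ => zero_le) z
    · rw [ind, ind, indicator_of_mem hx, indicator_of_mem hyA]
      rfl
  · rw [ind, indicator_of_notMem hx]
    refine iSup₂_eq_bot.2 fun y hy => indicator_of_notMem (fun hyA => hx ?_) _
    exact Metric.mem_thickening_iff.2 ⟨y, hyA, Metric.mem_ball'.1 hy⟩

lemma iInf_ball_ind (hε : 0 < ε) (A : Set X) (x : X) :
    ⨅ x' ∈ Metric.ball x ε, ind A x' = ind (erosion ε A) x := by
  by_cases hx : x ∈ erosion ε A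
  · have hind : ∀ y ∈ Metric.ball x ε, ind A y = 1 :=
      fun y hy => indicator_of_mem (mem_erosion_iff.1 hx hy) _
    rw [ind, indicator_of_mem hx, biInf_congr hind]
    exact biInf_const ⟨x, Metric.mem_ball_self hε⟩
  · obtain ⟨y, hy, hyA⟩ := not_subset.1 (mem_erosion_iff.not.1 hx)
    rw [ind, indicator_of_notMem hx, ← nonpos_iff_eq_zero]
    exact iInf₂_le_of_le y hy (indicator_of_notMem hyA _).le

end Indicator

/-! ### The class measures of the data distribution -/

section ClassMeasure

variable {X : Type*} [MeasurableSpace X] {μ : Measure (X × Fin 2)} {ν : Measure X} {A B : Set X}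

/-- The part `w_i ρ_i` of the data distribution with label `i`. -/
def classMeasure (μ : Measure (X × Fin 2)) (i : Fin 2) : Measure X :=
  (μ.restrict (Prod.snd ⁻¹' {i})).map Prod.fst

lemma classMeasure_le_dataMarginal (μ : Measure (X × Fin 2)) (i : Fin 2) :
    classMeasure μ i ≤ dataMarginal μ :=
  Measure.map_mono Measure.restrict_le_self measurable_fst

lemma classWeight_smul_classDist (μ : Measure (X × Fin 2)) [IsFiniteMeasure μ] (i : Fin 2) :
    classWeight μ i • classDist μ i = classMeasure μ i := by
  rw [classDist, ProbabilityTheory.cond, Measure.map_smul, smul_smul, classWeight, classMeasure]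
  by_cases h : μ (Prod.snd ⁻¹' {i}) = 0
  · rw [Measure.restrict_eq_zero.2 h, Measure.map_zero, smul_zero]
  · rw [ENNReal.mul_inv_cancel h (measure_ne_top _ _), one_smul]

lemma lintegral_eq_sum_classMeasure {f : X × Fin 2 → ℝ≥0∞}
    (hf : ∀ i, Measurable fun x => f (x, i)) :
    ∫⁻ z, f z ∂μ = ∑ i, ∫⁻ x, f (x, i) ∂classMeasure μ i := by
  have hmeas (i : Fin 2) : MeasurableSet (Prod.snd ⁻¹' {i} : Set (X × Fin 2)) :=
    measurable_snd (measurableSet_singleton i)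
  have hdisj : Pairwise (Function.onFun Disjoint
      fun i : Fin 2 => (Prod.snd ⁻¹' {i} : Set (X × Fin 2))) :=
    pairwise_disjoint_fiber Prod.snd
  calc ∫⁻ z, f z ∂μ = ∫⁻ z in ⋃ i, Prod.snd ⁻¹' {i}, f z ∂μ := by
        rw [← preimage_iUnion, iUnion_of_singleton, preimage_univ, setLIntegral_univ]
    _ = ∑ i, ∫⁻ z in Prod.snd ⁻¹' {i}, f z ∂μ := by
        rw [lintegral_iUnion hmeas hdisj, tsum_fintype]
    _ = ∑ i, ∫⁻ x, f (x, i) ∂classMeasure μ i := by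
        refine Finset.sum_congr rfl fun i _ => ?_
        rw [classMeasure, lintegral_map (hf i) measurable_fst]
        refine setLIntegral_congr_fun (hmeas i) fun z hz => ?_
        obtain rfl : z.2 = i := hz
        rfl

lemma lintegral_loss (hA : MeasurableSet A) :
    ∫⁻ z, loss A z.1 z.2 ∂μ = classMeasure μ 0 A + classMeasure μ 1 Aᶜ := by
  rw [lintegral_eq_sum_classMeasure, Fin.sum_univ_two]
  · simp only [loss_zero, loss_one, lintegral_ind hA, lintegral_ind hA.compl]
  · rw [Fin.forall_fin_two]
    simpa only [loss_zero, loss_one] using ⟨measurable_ind hA, measurable_ind hA.compl⟩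

lemma lintegral_loss_congr_ae (hμν : dataMarginal μ ≪ ν) (hA : MeasurableSet A)
    (hB : MeasurableSet B) (h : A =ᵐ[ν] B) :
    ∫⁻ z, loss A z.1 z.2 ∂μ = ∫⁻ z, loss B z.1 z.2 ∂μ := by
  have hac (i : Fin 2) : classMeasure μ i ≪ ν :=
    (classMeasure_le_dataMarginal μ i).absolutelyContinuous.trans hμν
  rw [lintegral_loss hA, lintegral_loss hB, measure_congr ((hac 0).ae_eq h),
    measure_congr ((hac 1).ae_eq h.compl)]

lemma nuEquiv_iff : NuEquiv ν A B ↔ A =ᵐ[ν] B := measure_symmDiff_eq_zero_iff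

lemma nuLE_iff : NuLE ν A B ↔ A ≤ᵐ[ν] B := by
  refine eventually_congr (.of_forall fun x => ?_)
  change _ ↔ (x ∈ A → x ∈ B)
  by_cases hA : x ∈ A <;> by_cases hB : x ∈ B <;> simp [ind, hA, hB]

end ClassMeasure

/-! ### The two risks in terms of dilations -/

section Risk

variable {X : Type*} [MetricSpace X] [MeasurableSpace X] [OpensMeasurableSpace X]
variable {μ : Measure (X × Fin 2)} {ν : Measure X} {ε : ℝ} {A : Set X}

lemma advRisk_eq_thickeningRisk (ε : ℝ) (μ : Measure (X × Fin 2)) (A : Set X) :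
    advRisk ε μ A = thickeningRisk (classMeasure μ 0) (classMeasure μ 1) ε A := by
  have hmeas (B : Set X) : MeasurableSet (Metric.thickening ε B) :=
    Metric.isOpen_thickening.measurableSet
  rw [advRisk, lintegral_eq_sum_classMeasure, Fin.sum_univ_two]
  · simp only [loss_zero, loss_one, iSup_ball_ind, lintegral_ind (hmeas _), thickeningRisk]
  · rw [Fin.forall_fin_two]
    simpa only [loss_zero, loss_one, iSup_ball_ind] using
      ⟨measurable_ind (hmeas A), measurable_ind (hmeas Aᶜ)⟩

variable [IsFiniteMeasure μ]

lemma ofReal_mul_prePerimeter (hε : 0 < ε) (hA : MeasurableSet A) :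
    ENNReal.ofReal ε * prePerimeter ε μ A =
      classMeasure μ 0 (Metric.thickening ε A \ A) +
        classMeasure μ 1 (Metric.thickening ε Aᶜ \ Aᶜ) := by
  have hcancel (i : Fin 2) (I : ℝ≥0∞) :
      ENNReal.ofReal ε * (classWeight μ i / ENNReal.ofReal ε * I) = classWeight μ i * I := by
    rw [← mul_assoc, ENNReal.mul_div_cancel (ENNReal.ofReal_pos.2 hε).ne' ENNReal.ofReal_ne_top]
  have hclass (i : Fin 2) {B : Set X} (hB : MeasurableSet B) :
      classWeight μ i * ∫⁻ x, ind B x ∂classDist μ i = classMeasure μ i B := by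
    rw [lintegral_ind hB, ← classWeight_smul_classDist, Measure.smul_apply, smul_eq_mul]
  have hdiff : A \ erosion ε A = Metric.thickening ε Aᶜ \ Aᶜ := by
    rw [sdiff_eq, compl_erosion, sdiff_compl]
    exact inter_comm _ _
  rw [prePerimeter, mul_add, hcancel, hcancel]
  simp only [iSup_ball_ind, iInf_ball_ind hε, ind_sub_ind, hdiff]
  rw [hclass 0 (Metric.isOpen_thickening.measurableSet.diff hA),
    hclass 1 (Metric.isOpen_thickening.measurableSet.diff hA.compl)]

lemma lintegral_loss_add_prePerimeter (hε : 0 < ε) (hA : MeasurableSet A) :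
    ∫⁻ z, loss A z.1 z.2 ∂μ + ENNReal.ofReal ε * prePerimeter ε μ A =
      thickeningRisk (classMeasure μ 0) (classMeasure μ 1) ε A := by
  have hadd (m : Measure X) {B : Set X} (hB : MeasurableSet B) :
      m B + m (Metric.thickening ε B \ B) = m (Metric.thickening ε B) := by
    rw [measure_add_sdiff hB.nullMeasurableSet,
      union_eq_self_of_subset_left (Metric.self_subset_thickening hε B)]
  rw [lintegral_loss hA, ofReal_mul_prePerimeter hε hA, add_add_add_comm, hadd _ hA,
    hadd _ hA.compl, thickeningRisk]

lemma perRisk_eq_iInf_thickeningRisk (hε : 0 < ε) (hμν : dataMarginal μ ≪ ν)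
    (hA : MeasurableSet A) :
    perRisk ν ε μ A = ⨅ (B) (_ : MeasurableSet B) (_ : A =ᵐ[ν] B),
      thickeningRisk (classMeasure μ 0) (classMeasure μ 1) ε B := by
  simp only [perRisk, perimeter, nuEquiv_iff, ENNReal.add_iInf,
    ENNReal.mul_iInf_of_ne (ENNReal.ofReal_pos.2 hε).ne' ENNReal.ofReal_ne_top]
  refine iInf_congr fun B => iInf_congr fun hB => iInf_congr fun hAB => ?_
  rw [lintegral_loss_congr_ae hμν hA hB hAB, lintegral_loss_add_prePerimeter hε hB]

lemma perRisk_eq_essThickeningRisk [SecondCountableTopology X] (hε : 0 < ε)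
    (hμν : dataMarginal μ ≪ ν) (h₀ : ∀ᵐ x ∂classMeasure μ 0, Metric.ball x ε ⊆ ν.support)
    (hA : MeasurableSet A) :
    perRisk ν ε μ A = essThickeningRisk ν (classMeasure μ 0) (classMeasure μ 1) ε A := by
  rw [perRisk_eq_iInf_thickeningRisk hε hμν hA]
  refine le_antisymm ?_ (le_iInf fun B => le_iInf₂ fun _ hAB => ?_)
  · obtain ⟨B, hB, hAB, hle⟩ := exists_ae_eq_thickeningRisk_le h₀ (classMeasure μ 1) hA
    exact iInf_le_of_le B (iInf₂_le_of_le hB hAB hle)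
  · rw [essThickeningRisk_congr_ae hAB]
    exact essThickeningRisk_le_thickeningRisk ν _ _ ε B

end Risk

/-! ### Solutions of the two problems -/

section Solutions

variable {X : Type*} [MetricSpace X] [MeasurableSpace X]
variable {μ : Measure (X × Fin 2)} {ν m₀ m₁ : Measure X} {ε : ℝ} {A : Set X}

lemma IsReferenceMeasure.ae_ball_subset_support [SecondCountableTopology X]
    (hν : IsReferenceMeasure ν ε μ) (i : Fin 2) :
    ∀ᵐ x ∂classMeasure μ i, Metric.ball x ε ⊆ ν.support := by
  refine (classMeasure_le_dataMarginal μ i).absolutelyContinuous.ae_le ?_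
  filter_upwards [Measure.support_mem_ae (μ := dataMarginal μ)] with x hx y hy
  exact hν.thickening_subset (Metric.mem_thickening_iff.2 ⟨x, hx, hy⟩)

variable [OpensMeasurableSpace X]

lemma isAdvSolution_iff : IsAdvSolution ε μ A ↔
    IsMinimizer (thickeningRisk (classMeasure μ 0) (classMeasure μ 1) ε) A :=
  isMinimizer_congr fun B _ => advRisk_eq_thickeningRisk ε μ B

variable [SecondCountableTopology X]

lemma IsMinimizer.closing_upperRep (hA : IsMinimizer (essThickeningRisk ν m₀ m₁ ε) A)
    (h₀ : ∀ᵐ x ∂m₀, Metric.ball x ε ⊆ ν.support) (h₁ : ∀ᵐ x ∂m₁, Metric.ball x ε ⊆ ν.support)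
    (hAν : A ≤ᵐ[ν] upperRep ν A) :
    IsMinimizer (thickeningRisk m₀ m₁ ε) (closing ε (upperRep ν A)) :=
  ⟨(isClosed_closing ε _).measurableSet, fun B hB =>
    (thickeningRisk_closing_upperRep_le h₀ h₁ hAν).trans <|
      (hA.2 B hB).trans (essThickeningRisk_le_thickeningRisk ν m₀ m₁ ε B)⟩

lemma IsAEGreatestMinimizer.ae_eq_closing_upperRep
    (hA : IsAEGreatestMinimizer ν (essThickeningRisk ν m₀ m₁ ε) A)
    (h₀ : ∀ᵐ x ∂m₀, Metric.ball x ε ⊆ ν.support) (h₁ : ∀ᵐ x ∂m₁, Metric.ball x ε ⊆ ν.support)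
    (hAν : A ≤ᵐ[ν] upperRep ν A) : A =ᵐ[ν] closing ε (upperRep ν A) := by
  refine (hAν.trans (subset_closing ε _).eventuallyLE).antisymm
    (hA.2 _ ⟨(isClosed_closing ε _).measurableSet, fun B hB => ?_⟩)
  calc essThickeningRisk ν m₀ m₁ ε (closing ε (upperRep ν A))
      ≤ thickeningRisk m₀ m₁ ε (closing ε (upperRep ν A)) :=
        essThickeningRisk_le_thickeningRisk ν m₀ m₁ ε _
    _ ≤ essThickeningRisk ν m₀ m₁ ε A := thickeningRisk_closing_upperRep_le h₀ h₁ hAν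
    _ ≤ essThickeningRisk ν m₀ m₁ ε B := hA.1.2 B hB

namespace IsReferenceMeasure

variable [IsFiniteMeasure μ]

lemma isPerSolution_iff (hν : IsReferenceMeasure ν ε μ) (hε : 0 < ε) :
    IsPerSolution ν ε μ A ↔
      IsMinimizer (essThickeningRisk ν (classMeasure μ 0) (classMeasure μ 1) ε) A :=
  isMinimizer_congr fun _ hB =>
    perRisk_eq_essThickeningRisk hε hν.absolutelyContinuous (hν.ae_ball_subset_support 0) hB

lemma isMaxPerSolution_iff (hν : IsReferenceMeasure ν ε μ) (hε : 0 < ε) :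
    IsMaxPerSolution ν ε μ A ↔ IsAEGreatestMinimizer ν
      (essThickeningRisk ν (classMeasure μ 0) (classMeasure μ 1) ε) A := by
  simp only [IsMaxPerSolution, hν.isPerSolution_iff hε, nuLE_iff, nuEquiv_iff,
    (isLSCSubmodular_essThickeningRisk _ _ _ _).isAEGreatestMinimizer_iff]

lemma isMinPerSolution_iff (hν : IsReferenceMeasure ν ε μ) (hε : 0 < ε) :
    IsMinPerSolution ν ε μ A ↔ IsAEGreatestMinimizer ν
      (essThickeningRisk ν (classMeasure μ 1) (classMeasure μ 0) ε) Aᶜ := by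
  have hle (B : Set X) : (Aᶜ : Set X) ≤ᵐ[ν] (Bᶜ : Set X) ↔ B ≤ᵐ[ν] A :=
    ⟨fun h => by simpa only [compl_compl] using h.compl, fun h => h.compl⟩
  have heq (B : Set X) : (Aᶜ : Set X) =ᵐ[ν] (Bᶜ : Set X) ↔ A =ᵐ[ν] B :=
    ⟨fun h => by simpa only [compl_compl] using h.compl, fun h => h.compl⟩
  rw [(isLSCSubmodular_essThickeningRisk _ _ _ _).isAEGreatestMinimizer_iff,
    compl_surjective.forall]
  simp only [IsMinPerSolution, hν.isPerSolution_iff hε, nuLE_iff, nuEquiv_iff,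
    isMinimizer_essThickeningRisk_compl, hle, heq]

end IsReferenceMeasure

end Solutions

end

end AdvTraining

open MeasureTheory AdvTraining in
theorem mainTheorem9_general {X : Type*} [MetricSpace X] [TopologicalSpace.SeparableSpace X]
    [MeasurableSpace X] [OpensMeasurableSpace X] (μ : Measure (X × Fin 2)) [IsFiniteMeasure μ]
    (ε : ℝ) (hε : 0 < ε) (ν : Measure X) [IsLocallyFiniteMeasure ν]
    (hν : IsReferenceMeasure ν ε μ) :
    (∃ Amax : Set X, IsMaxPerSolution ν ε μ Amax) ∧
    (∃ Amin : Set X, IsMinPerSolution ν ε μ Amin) ∧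
    ∃ Aplus Aminus : Set X,
      IsAdvSolution ε μ Aplus ∧ IsAdvSolution ε μ Aminus ∧
      Aminus ⊆ Aplus ∧
      IsClosed Aplus ∧ IsOpen Aminus ∧
      (AttainsDistance X ε → OuterRegularAt ε Aplus ∧ InnerRegularAt ε Aminus) ∧
      (∀ Amax : Set X, IsMaxPerSolution ν ε μ Amax →
        NuEquiv ν Amax Aplus ∧ Aplus = closing ε (upperRep ν Amax)) ∧
      (∀ Amin : Set X, IsMinPerSolution ν ε μ Amin →
        NuEquiv ν Amin Aminus ∧ Aminus = opening ε (lowerRep ν Amin)) := by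
  have : SecondCountableTopology X := UniformSpace.secondCountable_of_separable X
  have h₀ := hν.ae_ball_subset_support 0
  have h₁ := hν.ae_ball_subset_support 1
  have hrep := ae_le_upperRep hν.locallyDoubling
  obtain ⟨G, hG⟩ := (isLSCSubmodular_essThickeningRisk ν (classMeasure μ 0) (classMeasure μ 1)
    ε).exists_isAEGreatestMinimizer (ν := ν)
  obtain ⟨K, hK⟩ := (isLSCSubmodular_essThickeningRisk ν (classMeasure μ 1) (classMeasure μ 0)
    ε).exists_isAEGreatestMinimizer (ν := ν)
  refine ⟨⟨G, (hν.isMaxPerSolution_iff hε).2 hG⟩,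
    ⟨Kᶜ, (hν.isMinPerSolution_iff hε).2 (by rwa [compl_compl])⟩,
    closing ε (upperRep ν G), (closing ε (upperRep ν K))ᶜ,
    isAdvSolution_iff.2 (hG.1.closing_upperRep h₀ h₁ (hrep G)),
    isAdvSolution_iff.2 (isMinimizer_thickeningRisk_compl.2 (hK.1.closing_upperRep h₁ h₀ (hrep K))),
    ?_, isClosed_closing _ _, (isClosed_closing _ _).isOpen_compl,
    fun h => ⟨h.outerRegularAt_closing _, (h.outerRegularAt_closing _).innerRegularAt_compl⟩,
    fun A hA => ?_, fun A hA => ?_⟩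
  · have hKG : (Kᶜ : Set X) ≤ᵐ[ν] G := hG.2 _ (isMinimizer_essThickeningRisk_compl.2 hK.1)
    simpa only [opening_lowerRep hK.1.1.compl, compl_compl] using
      opening_lowerRep_subset_closing_upperRep ε hKG
  · have hA' := (hν.isMaxPerSolution_iff hε).1 hA
    rw [upperRep_congr_ae (hG.ae_eq hA'), nuEquiv_iff]
    exact ⟨hA'.ae_eq_closing_upperRep h₀ h₁ (hrep A), rfl⟩
  · have hA' := (hν.isMinPerSolution_iff hε).1 hA
    rw [upperRep_congr_ae (hK.ae_eq hA'), opening_lowerRep hA.1.1, nuEquiv_iff]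
    exact ⟨by simpa only [compl_compl] using (hA'.ae_eq_closing_upperRep h₁ h₀ (hrep Aᶜ)).compl,
      rfl⟩

theorem mainTheorem9 {X : Type*} [MetricSpace X] [TopologicalSpace.SeparableSpace X]
    [MeasurableSpace X] [BorelSpace X]
    (μ : MeasureTheory.Measure (X × Fin 2)) [MeasureTheory.IsProbabilityMeasure μ]
    (ε : ℝ) (hε : 0 < ε)
    (ν : MeasureTheory.Measure X) [MeasureTheory.IsFiniteMeasure ν]
    (hν : AdvTraining.IsReferenceMeasure ν ε μ) :
    (∃ Amax : Set X, AdvTraining.IsMaxPerSolution ν ε μ Amax) ∧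
    (∃ Amin : Set X, AdvTraining.IsMinPerSolution ν ε μ Amin) ∧
    ∃ Aplus Aminus : Set X,
      AdvTraining.IsAdvSolution ε μ Aplus ∧ AdvTraining.IsAdvSolution ε μ Aminus ∧
      Aminus ⊆ Aplus ∧
      IsClosed Aplus ∧ IsOpen Aminus ∧
      (AdvTraining.AttainsDistance X ε →
        AdvTraining.OuterRegularAt ε Aplus ∧ AdvTraining.InnerRegularAt ε Aminus) ∧
      (∀ Amax : Set X, AdvTraining.IsMaxPerSolution ν ε μ Amax →
        AdvTraining.NuEquiv ν Amax Aplus ∧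
        Aplus = AdvTraining.closing ε (AdvTraining.upperRep ν Amax)) ∧
      (∀ Amin : Set X, AdvTraining.IsMinPerSolution ν ε μ Amin →
        AdvTraining.NuEquiv ν Amin Aminus ∧
        Aminus = AdvTraining.opening ε (AdvTraining.lowerRep ν Amin)) :=
  mainTheorem9_general μ ε hε ν hν
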